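/- Let $\Gamma$ be a $\mathbb Z^d$-periodic graph: a (simple, undirected) graph with vertex set $\mathcal V$ and edge set $\mathcal E$, equipped with a free action of $\mathbb Z^d$ by graph automorphisms, written $(b,v)\mapsto b+v$, with finitely many orbits of vertices and of edges. Let $\Gamma$ be labeled by $\mathbb Z^d$-periodic functions $V\colon\mathcal V\to\mathbb R$ and $E\colon\mathcal E\to\mathbb R$. Let $W\subset\mathcal V$ be a fundamental domain (a set containing exactly one vertex of each orbit). For $z$ in the torus $\mathbb T^d=\{z\in\mathbb C^d : |z_1|=\dots=|z_d|=1\}$, the Floquet matrix $H(z)$ is the Hermitian $W\times W$ matrix with entries $$H(z)_{v,u}=V(v)\,\delta_{v,u}+\sum_{b\in\mathbb Z^d,\ (v,b+u)\in\mathcal E}E(v,b+u)\,z^b,\qquad z^b=z_1^{b_1}\cdots z_d^{b_d}.$$ The spectral band functions of $\Gamma$ are the $|W|$ functions $\mathbb T^d\to\mathbb R$ sending $z$ to the $j$-th largest eigenvalue of $H(z)$, counted with multiplicity, for $j=1,\dots,|W|$. For a nonzero real number $a$, let $\mathbb Z_a$ be the infinite path with vertex set $\mathbb Z$, zero potential,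 and an edge labeled $a$ between $n$ and $n+1$ for each $n\in\mathbb Z$. The parallel extension $\Gamma_a=\mathbb Z_a\times\Gamma$ is the Cartesian product of graphs: its vertex set is $\mathbb Z\times\mathcal V$, and its edges are $(n,v)\sim(n+1,v)$, labeled $a$, and $(n,v)\sim(n,u)$ for each edge $(v,u)$ of $\Gamma$, labeled $E(v,u)$; the potential at $(n,v)$ is $V(v)$. It is $\mathbb Z^{d+1}$-periodic, the last coordinate of $\mathbb Z^{d+1}$ acting by translation on $\mathbb Z$ and the first $d$ coordinates acting on $\mathcal V$. A perfect Morse function on the torus $\mathbb T^d$ is a smooth function $f\colon\mathbb T^d\to\mathbb R$ all of whose critical points are nondegenerate and whose number of critical points equals the sum of the Betti numbers of $\mathbb T^d$. If every spectral band function of $\Gamma$ is a perfect Morse function on $\mathbb T^d$, then for every real $a\neq0$ every spectral band function of the parallel extension $\Gamma_a$ is a perfect Morse function on $\mathbb T^{d+1}$. (This holds for every choice of fundamental domains of $\Gamma$ and of $\Gamma_a$.) -/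

import Mathlib

universe u

noncomputable section

/-! ### Morse theory on the torus -/

/-- The compact torus `𝕋 ^ d`, a product of `d` unit circles in `ℂ`. -/
abbrev Torus (d : ℕ) : Type := Fin d → Circle

namespace Torus

variable {d : ℕ}

/-- Angle coordinates of the torus centred at `z`: the smooth covering map
`ℝ ^ d → 𝕋 ^ d`, `θ ↦ (z₁ e ^ (i θ₁), …, z_d e ^ (i θ_d))`, which restricts to a smooth chart
near `θ = 0` and sends `0` to `z`. -/
def angle (z : Torus d) (θ : Fin d → ℝ) : Torus d := fun i => z i * Circle.exp (θ i)

/-- A real function on the torus is smooth: it is `C ^ ∞` in angle coordinates. -/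
def IsSmooth (f : Torus d → ℝ) : Prop :=
  ∀ z : Torus d, ContDiff ℝ ((⊤ : ℕ∞) : WithTop ℕ∞) (fun θ => f (angle z θ))

/-- The critical points of a (smooth) function on the torus: its differential vanishes. -/
def criticalPoints (f : Torus d → ℝ) : Set (Torus d) :=
  {z | fderiv ℝ (fun θ => f (angle z θ)) 0 = 0}

/-- The Hessian of `f` at `z` in angle coordinates, as a bilinear form. -/
def hessian (f : Torus d → ℝ) (z : Torus d) : (Fin d → ℝ) →L[ℝ] (Fin d → ℝ) →L[ℝ] ℝ :=
  fderiv ℝ (fun x => fderiv ℝ (fun θ => f (angle z θ)) x) 0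

/-- A Morse function on the torus: smooth, and every critical point is nondegenerate (the kernel
of the Hessian is zero). -/
def IsMorse (f : Torus d → ℝ) : Prop :=
  IsSmooth f ∧ ∀ z ∈ criticalPoints f, ∀ x : Fin d → ℝ, (∀ y, hessian f z x y = 0) → x = 0

end Torus

/-- The `n`-th Betti number of a topological space: the dimension of its `n`-th singular homology
with rational coefficients. -/
def bettiNumber (X : Type) [TopologicalSpace X] (n : ℕ) : Cardinal :=
  Module.rank ℚ
    (((AlgebraicTopology.singularHomologyFunctor (ModuleCat.{0} ℚ) n).obj
      (ModuleCat.of ℚ ℚ)).obj (TopCat.of X))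

/-- The sum of all Betti numbers of a topological space. -/
def totalBetti (X : Type) [TopologicalSpace X] : Cardinal :=
  Cardinal.sum (fun n : ℕ => bettiNumber X n)

/-- A perfect Morse function on the torus: a Morse function whose number of critical points is
the sum of the Betti numbers of the torus. -/
def Torus.IsPerfectMorse {d : ℕ} (f : Torus d → ℝ) : Prop :=
  Torus.IsMorse f ∧ Cardinal.mk (Torus.criticalPoints f) = totalBetti (Torus d)

/-! ### Labeled periodic graphs -/

/-- A labeled `ℤ ^ d`-periodic graph: a graph with a free action of `ℤ ^ d` that has finitely many
orbits of vertices and of edges, with periodic real labels on vertices and edges. -/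
structure LabeledPeriodicGraph (d : ℕ) where
  /-- The vertices. -/
  Vert : Type u
  [action : AddAction (Fin d → ℤ) Vert]
  /-- The underlying graph. -/
  graph : SimpleGraph Vert
  adj_vadd : ∀ (a : Fin d → ℤ) {v w : Vert}, graph.Adj v w → graph.Adj (a +ᵥ v) (a +ᵥ w)
  free : ∀ (a : Fin d → ℤ) (v : Vert), a +ᵥ v = v → a = 0
  finite_vert : ∃ S : Finset Vert, ∀ v, ∃ a : Fin d → ℤ, ∃ s ∈ S, a +ᵥ s = v
  finite_edge : ∃ S : Finset (Vert × Vert), ∀ v w, graph.Adj v w →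
    ∃ a : Fin d → ℤ, ∃ s ∈ S, a +ᵥ s.1 = v ∧ a +ᵥ s.2 = w
  /-- The potential. -/
  V : Vert → ℝ
  V_vadd : ∀ (a : Fin d → ℤ) (v : Vert), V (a +ᵥ v) = V v
  /-- The edge labels: `E h` is the label of the edge between `v` and `w`. -/
  E : ∀ {v w : Vert}, graph.Adj v w → ℝ
  E_symm : ∀ {v w : Vert} (h : graph.Adj v w), E h.symm = E h
  E_vadd : ∀ (a : Fin d → ℤ) {v w : Vert} (h : graph.Adj v w), E (adj_vadd a h) = E h

attribute [instance] LabeledPeriodicGraph.action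

namespace LabeledPeriodicGraph

variable {d : ℕ} (Γ : LabeledPeriodicGraph.{u} d)

theorem adj_vadd_iff (a : Fin d → ℤ) {v w : Γ.Vert} :
    Γ.graph.Adj (a +ᵥ v) (a +ᵥ w) ↔ Γ.graph.Adj v w := by
  refine ⟨fun h => ?_, Γ.adj_vadd a⟩
  simpa using Γ.adj_vadd (-a) h

/-- A fundamental domain: a set containing exactly one vertex of every orbit (it is finite, as
there are finitely many orbits). -/
structure FundamentalDomain where
  /-- The chosen orbit representatives. -/
  carrier : Finset Γ.Vert
  existsUnique_mem : ∀ v : Γ.Vert, ∃! w, w ∈ carrier ∧ ∃ a : Fin d → ℤ, a +ᵥ w = v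

open Classical in
/-- The label of the edge between `v` and `w`, and `0` if there is no such edge. -/
def weight (v w : Γ.Vert) : ℝ := if h : Γ.graph.Adj v w then Γ.E h else 0

theorem weight_comm (v w : Γ.Vert) : Γ.weight v w = Γ.weight w v := by
  unfold weight
  by_cases h : Γ.graph.Adj v w
  · rw [dif_pos h, dif_pos h.symm, Γ.E_symm]
  · rw [dif_neg h, dif_neg (fun h' => h h'.symm)]

theorem weight_vadd (a : Fin d → ℤ) (v w : Γ.Vert) :
    Γ.weight (a +ᵥ v) (a +ᵥ w) = Γ.weight v w := by
  unfold weight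
  by_cases h : Γ.graph.Adj v w
  · rw [dif_pos h, dif_pos (Γ.adj_vadd a h), Γ.E_vadd]
  · rw [dif_neg h, dif_neg (fun h' => h ((Γ.adj_vadd_iff a).1 h'))]

/-- The Laurent monomial `z ^ a = z₁ ^ a₁ ⋯ z_d ^ a_d`. -/
def monomial (z : Torus d) (a : Fin d → ℤ) : ℂ := ∏ i, (z i : ℂ) ^ (a i)

theorem star_monomial (z : Torus d) (a : Fin d → ℤ) :
    (starRingEnd ℂ) (monomial z a) = monomial z (-a) := by
  simp [monomial, map_prod, ← Circle.coe_inv_eq_conj]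

/-- Only finitely many translates of `w` are adjacent to `v`, so the sums in the Floquet matrix
are finite. -/
theorem finite_adj_vadd (v w : Γ.Vert) :
    {a : Fin d → ℤ | Γ.graph.Adj v (a +ᵥ w)}.Finite := by
  obtain ⟨S, hS⟩ := Γ.finite_edge
  choose! c s hs h1 h2 using hS
  refine Set.Finite.of_finite_image
    (f := fun a => s v (a +ᵥ w)) (S.finite_toSet.subset ?_) ?_
  · rintro _ ⟨a, ha, rfl⟩
    exact hs _ _ ha
  · intro a ha b hb hab
    have ha' : Γ.graph.Adj v (a +ᵥ w) := ha
    have hb' : Γ.graph.Adj v (b +ᵥ w) := hb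
    have hab' : s v (a +ᵥ w) = s v (b +ᵥ w) := hab
    have e1 := h1 _ _ ha'
    have e2 := h1 _ _ hb'
    have e3 := h2 _ _ ha'
    have e4 := h2 _ _ hb'
    rw [hab'] at e1 e3
    have hc : c v (a +ᵥ w) = c v (b +ᵥ w) := by
      have : (-(c v (b +ᵥ w)) + c v (a +ᵥ w)) +ᵥ (s v (b +ᵥ w)).1 = (s v (b +ᵥ w)).1 := by
        rw [add_vadd, e1, neg_vadd_eq_iff, e2]
      have := Γ.free _ _ this
      exact (neg_add_eq_zero.1 this).symm
    rw [hc, e4] at e3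
    have : (-b + a) +ᵥ w = w := by rw [add_vadd, neg_vadd_eq_iff, e3]
    exact (neg_add_eq_zero.1 (Γ.free _ _ this)).symm

variable {Γ}

open Classical in
/-- The Floquet matrix `H(z)`, with rows and columns indexed by a fundamental domain: the entry in
row `v` and column `w` is `V(v) δ_{v,w} + ∑ E(v, a + w) z ^ a`, the sum over all `a ∈ ℤ ^ d` such
that `(v, a + w)` is an edge. -/
def floquetMatrix (W : Γ.FundamentalDomain) (z : Torus d) :
    Matrix W.carrier W.carrier ℂ :=
  Matrix.of fun v w => (if v = w then (Γ.V v : ℂ) else 0) +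
    ∑ᶠ a : Fin d → ℤ, (Γ.weight v (a +ᵥ (w : Γ.Vert)) : ℂ) * monomial z a

theorem floquetMatrix_isHermitian (W : Γ.FundamentalDomain) (z : Torus d) :
    (floquetMatrix W z).IsHermitian := by
  classical
  ext v w
  have key : (starRingEnd ℂ)
      (∑ᶠ a : Fin d → ℤ, (Γ.weight w (a +ᵥ (v : Γ.Vert)) : ℂ) * monomial z a) =
      ∑ᶠ a : Fin d → ℤ, (Γ.weight v (a +ᵥ (w : Γ.Vert)) : ℂ) * monomial z a := by
    rw [← finsum_comp_equiv (Equiv.neg (Fin d → ℤ))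
      (f := fun a : Fin d → ℤ => (Γ.weight v (a +ᵥ (w : Γ.Vert)) : ℂ) * monomial z a)]
    have := AddEquiv.map_finsum (starRingAut (R := ℂ)).toAddEquiv
      (fun a : Fin d → ℤ => (Γ.weight w (a +ᵥ (v : Γ.Vert)) : ℂ) * monomial z a)
    refine this.trans (finsum_congr fun a => ?_)
    change (starRingEnd ℂ) _ = _
    rw [map_mul, star_monomial, Complex.conj_ofReal, ← Γ.weight_vadd (-a), neg_vadd_vadd,
      Γ.weight_comm]
    rfl
  simp only [Matrix.conjTranspose_apply, floquetMatrix, Matrix.of_apply, star_add]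
  congr 1
  by_cases h : v = w
  · subst h; simp
  · simp [h, Ne.symm h]

open Classical in
/-- The spectral band functions: the `j`-th one sends `z` to the `j`-th largest eigenvalue, counted
with multiplicity, of the Hermitian matrix `H(z)`. -/
def band (W : Γ.FundamentalDomain) (j : Fin (Fintype.card W.carrier)) (z : Torus d) : ℝ :=
  (floquetMatrix_isHermitian W z).eigenvalues₀ j

/-! ### Parallel extensions -/

/-- `ℤ ^ (d + 1)` acts on `ℤ × 𝒱`: the last coordinate translates `ℤ`, the others act on `𝒱`. -/
@[reducible]
def parallelAction (X : Type u) [AddAction (Fin d → ℤ) X] :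
    AddAction (Fin (d + 1) → ℤ) (ℤ × X) where
  vadd a p := (a (Fin.last d) + p.1, (Fin.init a : Fin d → ℤ) +ᵥ p.2)
  zero_vadd p := Prod.ext (zero_add _) (zero_vadd (Fin d → ℤ) p.2)
  add_vadd a b p := Prod.ext (add_assoc _ _ _)
    (add_vadd (Fin.init a : Fin d → ℤ) (Fin.init b : Fin d → ℤ) p.2)

/-- The infinite path: `m` and `n` are adjacent exactly when they differ by one. -/
def integerPath : SimpleGraph ℤ where
  Adj m n := n = m + 1 ∨ m = n + 1
  symm := ⟨fun _ _ h => h.symm⟩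
  loopless := ⟨fun m h => by omega⟩

open Classical in
/-- The parallel extension `Γ_a = ℤ_a × Γ`: the Cartesian product of graphs of the infinite path,
all of whose edges are labeled `a` (and whose potential is zero), and `Γ`. -/
def parallelExtension (Γ : LabeledPeriodicGraph.{u} d) (a : ℝ) :
    LabeledPeriodicGraph.{u} (d + 1) where
  Vert := ℤ × Γ.Vert
  action := parallelAction Γ.Vert
  graph := integerPath.boxProd Γ.graph
  adj_vadd b v w h := by
    rcases h with ⟨h, h'⟩ | ⟨h, h'⟩
    · refine Or.inl ⟨?_, congrArg (fun x : Γ.Vert => (Fin.init b : Fin d → ℤ) +ᵥ x) h'⟩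
      change b _ + w.1 = b _ + v.1 + 1 ∨ b _ + v.1 = b _ + w.1 + 1
      change w.1 = v.1 + 1 ∨ v.1 = w.1 + 1 at h
      omega
    · exact Or.inr ⟨Γ.adj_vadd _ h, congrArg (fun n : ℤ => b (Fin.last d) + n) h'⟩
  free b v h := by
    have h1 : b (Fin.last d) + v.1 = v.1 := congrArg Prod.fst h
    have h2 := Γ.free _ _ (congrArg Prod.snd h)
    funext i
    refine Fin.lastCases ?_ (fun i => ?_) i
    · simpa using h1
    · exact congrFun h2 i
  finite_vert := by
    obtain ⟨S, hS⟩ := Γ.finite_vert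
    refine ⟨S.image fun s => ((0 : ℤ), s), fun v => ?_⟩
    obtain ⟨b, s, hs, h⟩ := hS v.2
    refine ⟨Fin.snoc (α := fun _ => ℤ) b v.1, _, Finset.mem_image_of_mem _ hs, Prod.ext ?_ ?_⟩
    · change Fin.snoc (α := fun _ => ℤ) b v.1 (Fin.last d) + 0 = v.1
      simp
    · change (Fin.init (Fin.snoc (α := fun _ => ℤ) b v.1) : Fin d → ℤ) +ᵥ s = v.2
      rw [Fin.init_snoc, h]
  finite_edge := by
    obtain ⟨S, hS⟩ := Γ.finite_vert
    obtain ⟨T, hT⟩ := Γ.finite_edge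
    refine ⟨(S.image fun s => (((0 : ℤ), s), ((1 : ℤ), s))) ∪
      (S.image fun s => (((1 : ℤ), s), ((0 : ℤ), s))) ∪
      (T.image fun t => (((0 : ℤ), t.1), ((0 : ℤ), t.2))), ?_⟩
    rintro ⟨m, v⟩ ⟨n, w⟩ (⟨h | h, h'⟩ | ⟨h, h'⟩)
    · obtain ⟨b, s, hs, e⟩ := hS v
      dsimp only at h h'
      refine ⟨Fin.snoc (α := fun _ => ℤ) b m, (((0 : ℤ), s), ((1 : ℤ), s)), ?_, ?_, ?_⟩
      · exact Finset.mem_union_left _ (Finset.mem_union_left _ (Finset.mem_image_of_mem _ hs))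
      all_goals
        refine Prod.ext ?_ ?_
        · change Fin.snoc (α := fun _ => ℤ) b m (Fin.last d) + _ = _
          simp [h]
        · change (Fin.init (Fin.snoc (α := fun _ => ℤ) b m) : Fin d → ℤ) +ᵥ s = _
          rw [Fin.init_snoc, e]
          try exact h'
    · obtain ⟨b, s, hs, e⟩ := hS v
      dsimp only at h h'
      refine ⟨Fin.snoc (α := fun _ => ℤ) b n, (((1 : ℤ), s), ((0 : ℤ), s)), ?_, ?_, ?_⟩
      · exact Finset.mem_union_left _ (Finset.mem_union_right _ (Finset.mem_image_of_mem _ hs))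
      all_goals
        refine Prod.ext ?_ ?_
        · change Fin.snoc (α := fun _ => ℤ) b n (Fin.last d) + _ = _
          simp [h]
        · change (Fin.init (Fin.snoc (α := fun _ => ℤ) b n) : Fin d → ℤ) +ᵥ s = _
          rw [Fin.init_snoc, e]
          try exact h'
    · obtain ⟨b, t, ht, e1, e2⟩ := hT v w h
      dsimp only at h'
      refine ⟨Fin.snoc (α := fun _ => ℤ) b m, (((0 : ℤ), t.1), ((0 : ℤ), t.2)), ?_, ?_, ?_⟩
      · exact Finset.mem_union_right _ (Finset.mem_image_of_mem _ ht)
      all_goals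
        refine Prod.ext ?_ ?_
        · change Fin.snoc (α := fun _ => ℤ) b m (Fin.last d) + 0 = _
          simp [h']
      · change (Fin.init (Fin.snoc (α := fun _ => ℤ) b m) : Fin d → ℤ) +ᵥ t.1 = _
        rw [Fin.init_snoc, e1]
      · change (Fin.init (Fin.snoc (α := fun _ => ℤ) b m) : Fin d → ℤ) +ᵥ t.2 = _
        rw [Fin.init_snoc, e2]
  V v := Γ.V v.2
  V_vadd b v := Γ.V_vadd _ v.2
  E {v w} _ := if h : Γ.graph.Adj v.2 w.2 then Γ.E h else a
  E_symm {v w} _ := by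
    by_cases h : Γ.graph.Adj v.2 w.2
    · rw [dif_pos h, dif_pos h.symm, Γ.E_symm]
    · rw [dif_neg h, dif_neg (fun h' => h h'.symm)]
  E_vadd b v w _ := by
    by_cases h : Γ.graph.Adj v.2 w.2
    · exact (dif_pos (Γ.adj_vadd _ h)).trans ((Γ.E_vadd _ h).trans (dif_pos h).symm)
    · exact (dif_neg (fun h' => h ((Γ.adj_vadd_iff _).1 h'))).trans
        (by rw [dif_neg h])

end LabeledPeriodicGraph

end

section

open CategoryTheory Limits Simplicial

theorem exists_sub_shift_eq {A : Type*} [AddCommGroup A] (g : ℤ → A) :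
    ∃ r : ℤ → A, r 0 = 0 ∧ ∀ m, r m - r (m + 1) = g m := by
  refine ⟨fun m => Int.rec (fun n => -∑ k ∈ Finset.range n, g k)
    (fun n => ∑ k ∈ Finset.range (n + 1), g (Int.negSucc k)) m, ?_, ?_⟩
  · change -∑ k ∈ Finset.range 0, g k = 0
    simp
  · rintro (n | n)
    · have : Int.ofNat n + 1 = Int.ofNat (n + 1) := rfl
      rw [this]
      simp [Finset.sum_range_succ]
    · cases n with
      | zero =>
        change (∑ k ∈ Finset.range 1, g (Int.negSucc k)) - -∑ k ∈ Finset.range 0, g k = _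
        simp
      | succ n =>
        change (∑ k ∈ Finset.range (n + 1 + 1), g (Int.negSucc k)) -
          (∑ k ∈ Finset.range (n + 1), g (Int.negSucc k)) = _
        rw [Finset.sum_range_succ]; simp

namespace SSet

variable {C : Type*} [Category* C] [HasCoproducts.{u} C] [Abelian C]

theorem shortExact_id_sub_chainComplexMap {K L : SSet.{u}} (t : K ⟶ K) (p : K ⟶ L)
    (w : t ≫ p = p)
    (h : ∀ n : ℕ, ∃ e : L _⦋n⦌ × ℤ ≃ K _⦋n⦌, (∀ x, p.app _ (e x) = x.1) ∧
      ∀ x m, t.app _ (e (x, m)) = e (x, m + 1)) (R : C) :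
    (ShortComplex.mk (𝟙 (K.chainComplex R) - chainComplexMap t R) (chainComplexMap p R) (by
      rw [Preadditive.sub_comp, ← Functor.map_comp, w, Category.id_comp, sub_self])).ShortExact := by
  apply HomologicalComplex.shortExact_of_degreewise_shortExact
  intro n
  obtain ⟨e, hp, ht⟩ := h n
  have ht' : ∀ m x, t.app _ (e (x, m)) = e (x, m + 1) := fun m x => ht x m
  choose r hr0 hr using fun x : L _⦋n⦌ =>
    exists_sub_shift_eq (fun m : ℤ => K.ιChainComplex (R := R) (e (x, m)))
  let ρ : (K.chainComplex R).X n ⟶ (K.chainComplex R).X n :=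
    Sigma.desc fun y => r (e.symm y).1 (e.symm y).2
  have hρ : ∀ y, K.ιChainComplex y ≫ ρ = r (e.symm y).1 (e.symm y).2 := fun y =>
    Sigma.ι_desc _ _
  let σ : (L.chainComplex R).X n ⟶ (K.chainComplex R).X n :=
    Sigma.desc fun x => K.ιChainComplex (e (x, 0))
  have hσ : ∀ x, L.ιChainComplex x ≫ σ = K.ιChainComplex (e (x, 0)) := fun x =>
    Sigma.ι_desc _ _
  have h1 : (𝟙 ((K.chainComplex R).X n) - (chainComplexMap t R).f n) ≫ ρ = 𝟙 _ := by
    refine chainComplex_hom_ext fun y => ?_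
    obtain ⟨⟨x, m⟩, rfl⟩ := e.surjective y
    simp only [Preadditive.sub_comp, Preadditive.comp_sub, Category.id_comp, Category.comp_id,
      ι_chainComplexMap_f_assoc, hρ, ht', e.symm_apply_apply, hr]
  have h2 : σ ≫ (chainComplexMap p R).f n = 𝟙 _ := by
    refine chainComplex_hom_ext fun x => ?_
    rw [reassoc_of% hσ]
    simp [hp]
  have h3 : ρ ≫ (𝟙 _ - (chainComplexMap t R).f n) + (chainComplexMap p R).f n ≫ σ = 𝟙 _ := by
    refine chainComplex_hom_ext fun y => ?_
    obtain ⟨⟨x, m⟩, rfl⟩ := e.surjective y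
    have key : ∀ m, r x m ≫ (𝟙 _ - (chainComplexMap t R).f n) =
        K.ιChainComplex (e (x, m)) - K.ιChainComplex (e (x, 0)) := by
      have step : ∀ m, r x m ≫ (𝟙 _ - (chainComplexMap t R).f n) -
          r x (m + 1) ≫ (𝟙 _ - (chainComplexMap t R).f n) =
          K.ιChainComplex (e (x, m)) - K.ιChainComplex (e (x, m + 1)) := by
        intro m
        rw [← Preadditive.sub_comp, hr]
        simp [Preadditive.comp_sub, ht]
      intro m
      induction m using Int.induction_on with
      | zero => simp [hr0]
      | succ k ih =>
        have := step k
        rw [ih] at this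
        rw [← sub_eq_zero] at this ⊢
        rw [← neg_eq_zero, ← this]; abel
      | pred k ih =>
        have := step (-k - 1)
        rw [sub_add_cancel, ih] at this
        rw [← sub_eq_zero] at this ⊢
        rw [← this]; abel
    simp only [Preadditive.comp_add, reassoc_of% hρ, e.symm_apply_apply, key,
      ι_chainComplexMap_f_assoc, hp, hσ, Category.comp_id]
    abel
  exact ShortComplex.Splitting.shortExact { r := ρ, s := σ, f_r := h1, s_g := h2, id := h3 }

end SSet

namespace ModuleCat

theorem rank_eq_of_iso {R : Type} [Ring R] {A B : ModuleCat.{0} R} (e : A ≅ B) :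
    Module.rank R A = Module.rank R B :=
  e.toLinearEquiv.rank_eq

theorem rank_homology_zero_of_shortExact {R : Type} [Ring R]
    {S : ShortComplex (ChainComplex (ModuleCat.{0} R) ℕ)} (hS : S.ShortExact)
    (h : ∀ n, HomologicalComplex.homologyMap S.f n = 0) :
    Module.rank R (S.X₃.homology 0) = Module.rank R (S.X₂.homology 0) := by
  have : Mono (HomologicalComplex.homologyMap S.g 0) := (hS.homology_exact₂ 0).mono_g (h _)
  have := hS.epi_g
  have : Epi (HomologicalComplex.homologyMap S.g 0) :=
    HomologicalComplex.epi_homologyMap_of_epi_of_not_rel _ _ (by simp)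
  have : IsIso (HomologicalComplex.homologyMap S.g 0) := isIso_of_mono_of_epi _
  exact (rank_eq_of_iso (asIso (HomologicalComplex.homologyMap S.g 0))).symm

variable {R : Type} [Ring R] [HasRankNullity.{0} R]

theorem rank_eq_add_of_exact {A B C : ModuleCat.{0} R} (f : A ⟶ B) (g : B ⟶ C)
    (w : f ≫ g = 0) (h : (ShortComplex.mk f g w).Exact) [Mono f] [Epi g] :
    Module.rank R B = Module.rank R A + Module.rank R C := by
  have hf : Function.Injective f := (ModuleCat.mono_iff_injective f).1 inferInstance
  have hg : Function.Surjective g := (ModuleCat.epi_iff_surjective g).1 inferInstance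
  have hfg : LinearMap.range f.hom = LinearMap.ker g.hom :=
    (ShortComplex.moduleCat_exact_iff_range_eq_ker _).1 h
  rw [← LinearMap.rank_range_add_rank_ker g.hom, ← hfg,
    rank_range_of_injective _ hf, LinearMap.range_eq_top.2 hg, rank_top, add_comm]

variable {S : ShortComplex (ChainComplex (ModuleCat.{0} R) ℕ)}

theorem rank_homology_succ_of_shortExact (hS : S.ShortExact)
    (h : ∀ n, HomologicalComplex.homologyMap S.f n = 0) (n : ℕ) :
    Module.rank R (S.X₃.homology (n + 1)) =
      Module.rank R (S.X₂.homology (n + 1)) + Module.rank R (S.X₁.homology n) := by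
  have : Mono (HomologicalComplex.homologyMap S.g (n + 1)) :=
    (hS.homology_exact₂ (n + 1)).mono_g (h _)
  have : Epi (hS.δ (n + 1) n rfl) := (hS.homology_exact₁ (n + 1) n rfl).epi_f (h _)
  exact rank_eq_add_of_exact _ _ _ (hS.homology_exact₃ (n + 1) n rfl)

end ModuleCat

end

section

open CategoryTheory Limits Simplicial AlgebraicTopology

namespace ContinuousMap

variable {A : Type*} [TopologicalSpace A]

theorem exists_circleExp_comp_eq [ContractibleSpace A] (f : C(A, Circle)) :
    ∃ g : C(A, ℝ), ∀ a, Circle.exp (g a) = f a := by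
  obtain ⟨y, hy⟩ := (id_nullhomotopic A)
  obtain ⟨F⟩ := hy.symm
  obtain ⟨c, hc⟩ := Circle.exp_surjective (f y)
  have h0 : ∀ a : A, (f.comp F.toContinuousMap) (0, a) = Circle.exp (const A c a) := by
    intro a
    simp [hc]
  refine ⟨(Circle.isCoveringMap_exp.liftHomotopy _ _ h0).comp ⟨fun a => (1, a), by fun_prop⟩,
    fun a => ?_⟩
  have := congrFun (Circle.isCoveringMap_exp.liftHomotopy_lifts _ _ h0) (1, a)
  simpa using this

theorem exists_eq_add_of_circleExp_comp_eq [PreconnectedSpace A] [Nonempty A] {g h : C(A, ℝ)}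
    (w : ∀ a, Circle.exp (g a) = Circle.exp (h a)) :
    ∃ m : ℤ, ∀ a, g a = h a + m * (2 * Real.pi) := by
  obtain ⟨a₀⟩ := ‹Nonempty A›
  obtain ⟨m, hm⟩ := Circle.exp_eq_exp.1 (w a₀)
  refine ⟨m, fun a => ?_⟩
  have key := Circle.isCoveringMap_exp.eq_of_comp_eq (g₁ := g)
    (g₂ := fun a => h a + m * (2 * Real.pi)) (by fun_prop) (by fun_prop)
    (by
      funext a
      simp only [Function.comp_apply, w a]
      exact Circle.exp_eq_exp.2 ⟨-m, by push_cast; ring⟩) a₀ hm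
  exact congrFun key a

theorem exists_equiv_prod_circle (X : Type*) [TopologicalSpace X] [ContractibleSpace A] :
    ∃ e : C(A, X × Circle) × ℤ ≃ C(A, X × ℝ),
      (∀ x a, ((e x a).1, Circle.exp (e x a).2) = x.1 a) ∧
      ∀ f m a, ((e (f, m) a).1, (e (f, m) a).2 + 2 * Real.pi) = e (f, m + 1) a := by
  choose l hl using fun f : C(A, X × Circle) => exists_circleExp_comp_eq (snd.comp f)
  have hl' : ∀ f a, Circle.exp (l f a) = (f a).2 := hl
  let e : C(A, X × Circle) × ℤ → C(A, X × ℝ) := fun x =>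
    ⟨fun a => ((x.1 a).1, l x.1 a + x.2 * (2 * Real.pi)), by fun_prop⟩
  have he : ∀ x a, e x a = ((x.1 a).1, l x.1 a + x.2 * (2 * Real.pi)) := fun _ _ => rfl
  have h1 : ∀ x a, ((e x a).1, Circle.exp (e x a).2) = x.1 a := by
    intro x a
    refine Prod.ext rfl ?_
    rw [← hl', he]
    exact Circle.exp_eq_exp.2 ⟨x.2, rfl⟩
  have hb : Function.Bijective e := by
    constructor
    · rintro ⟨f, m⟩ ⟨g, n⟩ h
      have hfg : f = g := by
        ext1 a
        rw [← h1 (f, m) a, h, h1]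
      subst hfg
      obtain ⟨a₀⟩ : Nonempty A := inferInstance
      have := congrArg Prod.snd (DFunLike.congr_fun h a₀)
      simp only [he] at this
      have := mul_right_cancel₀ Real.two_pi_pos.ne' (add_left_cancel this)
      exact Prod.ext rfl (by exact_mod_cast this)
    · intro k
      let f : C(A, X × Circle) := ⟨fun a => ((k a).1, Circle.exp (k a).2), by fun_prop⟩
      obtain ⟨m, hm⟩ := exists_eq_add_of_circleExp_comp_eq (g := snd.comp k) (h := l f)
        (fun a => (hl' f a).symm)
      exact ⟨(f, m), ext fun a => Prod.ext rfl (hm a).symm⟩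
  refine ⟨Equiv.ofBijective e hb, h1, fun f m a => Prod.ext rfl ?_⟩
  change l f a + m * (2 * Real.pi) + 2 * Real.pi = l f a + (m + 1 : ℤ) * (2 * Real.pi)
  push_cast; ring

end ContinuousMap

section

variable {X Y : Type} [TopologicalSpace X] [TopologicalSpace Y]

theorem bettiNumber_eq_of_homotopyEquiv (e : ContinuousMap.HomotopyEquiv X Y) (n : ℕ) :
    bettiNumber X n = bettiNumber Y n := by
  let f : TopCat.of X ⟶ TopCat.of Y := TopCat.ofHom e.toFun
  let g : TopCat.of Y ⟶ TopCat.of X := TopCat.ofHom e.invFun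
  let F := ((singularHomologyFunctor (ModuleCat.{0} ℚ) n).obj (ModuleCat.of ℚ ℚ))
  obtain ⟨h₁⟩ := e.left_inv
  obtain ⟨h₂⟩ := e.right_inv
  have h₁' : TopCat.Homotopy (f ≫ g) (𝟙 _) := h₁
  have h₂' : TopCat.Homotopy (g ≫ f) (𝟙 _) := h₂
  refine ModuleCat.rank_eq_of_iso (A := F.obj (.of X)) (B := F.obj (.of Y))
    ⟨F.map f, F.map g, ?_, ?_⟩
  · rw [← F.map_comp, ← F.map_id]
    exact h₁'.congr_homologyMap_singularChainComplexFunctor _ n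
  · rw [← F.map_comp, ← F.map_id]
    exact h₂'.congr_homologyMap_singularChainComplexFunctor _ n

theorem bettiNumber_eq_of_homeomorph (e : X ≃ₜ Y) (n : ℕ) : bettiNumber X n = bettiNumber Y n :=
  bettiNumber_eq_of_homotopyEquiv e.toHomotopyEquiv n

theorem bettiNumber_prod_of_contractible [ContractibleSpace Y] (n : ℕ) :
    bettiNumber (X × Y) n = bettiNumber X n := by
  obtain ⟨e⟩ := ContractibleSpace.hequiv_unit Y
  refine (bettiNumber_eq_of_homotopyEquiv
    ((ContinuousMap.HomotopyEquiv.refl X).prodCongr e) n).trans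
    (bettiNumber_eq_of_homeomorph (Homeomorph.prodPUnit X) n)

end

end

section

open CategoryTheory Limits Simplicial AlgebraicTopology

section

variable (X : Type) [TopologicalSpace X]

/-- The covering `X × ℝ → X × S¹`. -/
noncomputable def circleCover : TopCat.of (X × ℝ) ⟶ TopCat.of (X × Circle) :=
  TopCat.ofHom ⟨fun x => (x.1, Circle.exp x.2), by fun_prop⟩

/-- The generator of the deck transformations of the covering `X × ℝ → X × S¹`. -/
noncomputable def circleDeck : TopCat.of (X × ℝ) ⟶ TopCat.of (X × ℝ) :=
  TopCat.ofHom ⟨fun x => (x.1, x.2 + 2 * Real.pi), by fun_prop⟩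

theorem circleDeck_comp_circleCover : circleDeck X ≫ circleCover X = circleCover X := by
  ext x
  · rfl
  · exact congrArg _ (Circle.exp_add_two_pi x.2)

/-- The generator of the deck transformations is homotopic to the identity. -/
noncomputable def circleDeckHomotopy : TopCat.Homotopy (circleDeck X) (𝟙 _) where
  toFun x := (x.2.1, x.2.2 + (1 - (x.1 : ℝ)) * (2 * Real.pi))
  continuous_toFun := by fun_prop
  map_zero_left x := by simp [circleDeck]
  map_one_left x := by simp

theorem exists_equiv_toSSet_circleCover (n : ℕ) :
    ∃ e : (TopCat.toSSet.obj (.of (X × Circle))) _⦋n⦌ × ℤ ≃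
        (TopCat.toSSet.obj (.of (X × ℝ))) _⦋n⦌,
      (∀ x, (TopCat.toSSet.map (circleCover X)).app _ (e x) = x.1) ∧
      ∀ x m, (TopCat.toSSet.map (circleDeck X)).app _ (e (x, m)) = e (x, m + 1) := by
  have : ContractibleSpace (stdSimplex ℝ (Fin (n + 1))) :=
    (convex_stdSimplex ℝ _).contractibleSpace ⟨_, single_mem_stdSimplex ℝ 0⟩
  obtain ⟨e, he, he'⟩ :=
    ContinuousMap.exists_equiv_prod_circle (A := stdSimplex ℝ (Fin (n + 1))) X
  let a := TopCat.toSSetObjEquiv (.of (X × Circle)) (.op ⦋n⦌)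
  let b := TopCat.toSSetObjEquiv (.of (X × ℝ)) (.op ⦋n⦌)
  refine ⟨(a.prodCongr (Equiv.refl ℤ)).trans (e.trans b.symm), fun x => ?_, fun x m => ?_⟩
  · apply a.injective
    ext1 y
    exact (congrArg (fun k : C(_, X × ℝ) => ((k y).1, Circle.exp (k y).2))
      (b.apply_symm_apply (e (a x.1, x.2)))).trans (he (a x.1, x.2) y)
  · apply b.injective
    ext1 y
    refine (congrArg (fun k : C(_, X × ℝ) => ((k y).1, (k y).2 + 2 * Real.pi))
      (b.apply_symm_apply (e (a x, m)))).trans ((he' (a x) m y).trans ?_)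
    exact (DFunLike.congr_fun (b.apply_symm_apply (e (a x, m + 1))) y).symm

theorem shortExact_circleCover :
    ∃ S : ShortComplex (ChainComplex (ModuleCat.{0} ℚ) ℕ), S.ShortExact ∧
      (∀ n, HomologicalComplex.homologyMap S.f n = 0) ∧
      (∀ n, Module.rank ℚ (S.X₁.homology n) = bettiNumber X n) ∧
      (∀ n, Module.rank ℚ (S.X₂.homology n) = bettiNumber X n) ∧
      ∀ n, Module.rank ℚ (S.X₃.homology n) = bettiNumber (X × Circle) n := by
  refine ⟨_, SSet.shortExact_id_sub_chainComplexMap (C := ModuleCat.{0} ℚ)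
    (TopCat.toSSet.map (circleDeck X)) (TopCat.toSSet.map (circleCover X))
    (by rw [← Functor.map_comp, circleDeck_comp_circleCover])
    (exists_equiv_toSSet_circleCover X) (ModuleCat.of ℚ ℚ), fun n => ?_,
    fun n => bettiNumber_prod_of_contractible n, fun n => bettiNumber_prod_of_contractible n,
    fun n => rfl⟩
  dsimp only
  rw [HomologicalComplex.homologyMap_sub, sub_eq_zero]
  refine Eq.trans ?_ ((circleDeckHomotopy X).congr_homologyMap_singularChainComplexFunctor
    (ModuleCat.of ℚ ℚ) n).symm
  exact congrArg (fun k => HomologicalComplex.homologyMap k n)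
    (((singularChainComplexFunctor (ModuleCat.{0} ℚ)).obj (ModuleCat.of ℚ ℚ)).map_id
      (TopCat.of (X × ℝ))).symm

theorem bettiNumber_prod_circle_zero : bettiNumber (X × Circle) 0 = bettiNumber X 0 := by
  obtain ⟨S, hS, h, -, h₂, h₃⟩ := shortExact_circleCover X
  rw [← h₂, ← h₃, ModuleCat.rank_homology_zero_of_shortExact hS h]

theorem bettiNumber_prod_circle_succ (n : ℕ) :
    bettiNumber (X × Circle) (n + 1) = bettiNumber X (n + 1) + bettiNumber X n := by
  obtain ⟨S, hS, h, h₁, h₂, h₃⟩ := shortExact_circleCover X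
  rw [← h₃, ModuleCat.rank_homology_succ_of_shortExact hS h, h₁, h₂]

theorem Cardinal.sum_nat_eq_zero_add_sum_succ (f : ℕ → Cardinal.{0}) :
    Cardinal.sum f = f 0 + Cardinal.sum fun n => f (n + 1) := by
  have e : (Σ n, (f n).out) ≃ (f 0).out ⊕ Σ n, (f (n + 1)).out :=
    { toFun := fun x => match x with
        | ⟨0, y⟩ => Sum.inl y
        | ⟨n + 1, y⟩ => Sum.inr ⟨n, y⟩
      invFun := Sum.elim (fun y => ⟨0, y⟩) (fun x => ⟨x.1 + 1, x.2⟩)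
      left_inv := by rintro ⟨_ | n, y⟩ <;> rfl
      right_inv := by rintro (y | ⟨n, y⟩) <;> rfl }
  have := Cardinal.mk_congr e
  simpa [Cardinal.mk_sigma] using this

theorem totalBetti_prod_circle : totalBetti (X × Circle) = totalBetti X * 2 := by
  unfold totalBetti
  rw [Cardinal.sum_nat_eq_zero_add_sum_succ]
  simp only [bettiNumber_prod_circle_zero, bettiNumber_prod_circle_succ]
  rw [Cardinal.sum_add_distrib', ← add_assoc, ← Cardinal.sum_nat_eq_zero_add_sum_succ, mul_two]

theorem totalBetti_torus_succ (d : ℕ) : totalBetti (Torus (d + 1)) = totalBetti (Torus d) * 2 := by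
  rw [← totalBetti_prod_circle]
  let e : Torus (d + 1) ≃ₜ Torus d × Circle :=
    { toFun := fun z => (Fin.init z, z (Fin.last d))
      invFun := fun x => Fin.snoc (α := fun _ => Circle) x.1 x.2
      left_inv := fun z => Fin.snoc_init_self z
      right_inv := fun x => by simp
      continuous_toFun := by unfold Fin.init; fun_prop
      continuous_invFun := by fun_prop }
  unfold totalBetti
  simp only [bettiNumber_eq_of_homeomorph e]

end

end

namespace Torus

variable {d : ℕ}

/-- The projection of `ℝ ^ (d + 1)` onto its first `d` coordinates. -/
def initCLM (d : ℕ) : (Fin (d + 1) → ℝ) →L[ℝ] (Fin d → ℝ) :=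
  ContinuousLinearMap.pi fun i => ContinuousLinearMap.proj i.castSucc

/-- The last coordinate on `ℝ ^ (d + 1)`. -/
def lastCLM (d : ℕ) : (Fin (d + 1) → ℝ) →L[ℝ] ℝ := ContinuousLinearMap.proj (Fin.last d)

@[simp] theorem initCLM_snoc (x : Fin d → ℝ) (s : ℝ) :
    initCLM d (Fin.snoc (α := fun _ => ℝ) x s) = x := by
  ext i; simp [initCLM]

@[simp] theorem lastCLM_snoc (x : Fin d → ℝ) (s : ℝ) :
    lastCLM d (Fin.snoc (α := fun _ => ℝ) x s) = s := by
  simp [lastCLM]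

theorem eq_zero_of_initCLM_of_lastCLM {x : Fin (d + 1) → ℝ} (h : initCLM d x = 0)
    (h' : lastCLM d x = 0) : x = 0 := by
  funext i
  exact Fin.lastCases h' (fun i => congrFun h i) i

variable {g : Torus d → ℝ} {b : ℝ} {f : Torus (d + 1) → ℝ}
  (hf : ∀ z, f z = g (Fin.init z) + b * (z (Fin.last d) : ℂ).re)
include hf

theorem comp_angle_eq (z : Torus (d + 1)) {α : ℝ} (hα : Circle.exp α = z (Fin.last d)) :
    (fun θ => f (angle z θ)) =
      fun θ => g (angle (Fin.init z) (initCLM d θ)) + b * Real.cos (α + lastCLM d θ) := by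
  funext θ
  rw [hf]
  have h1 : (Fin.init (angle z θ) : Torus d) = angle (Fin.init z) (initCLM d θ) := rfl
  have h2 : angle z θ (Fin.last d) = Circle.exp (α + lastCLM d θ) := by
    rw [Circle.exp_add, hα]; rfl
  rw [h1, h2, Circle.coe_exp, Complex.exp_ofReal_mul_I_re]

theorem isSmooth_of_eq_add (hg : IsSmooth g) : IsSmooth f := by
  intro z
  obtain ⟨α, hα⟩ := Circle.exp_surjective (z (Fin.last d))
  rw [comp_angle_eq hf z hα]
  exact ((hg (Fin.init z)).comp (initCLM d).contDiff).add
    (contDiff_const.mul (Real.contDiff_cos.comp (contDiff_const.add (lastCLM d).contDiff)))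

theorem fderiv_comp_angle_eq (hg : IsSmooth g) (z : Torus (d + 1)) {α : ℝ}
    (hα : Circle.exp α = z (Fin.last d)) :
    (fderiv ℝ fun θ => f (angle z θ)) = fun x =>
      (fderiv ℝ (fun θ => g (angle (Fin.init z) θ)) (initCLM d x)).comp (initCLM d) +
        (-(b * Real.sin (α + lastCLM d x))) • lastCLM d := by
  funext x
  rw [comp_angle_eq hf z hα]
  have h1 : HasFDerivAt (fun θ => g (angle (Fin.init z) θ)) _ (initCLM d x) :=
    ((hg (Fin.init z)).differentiable (by simp) _).hasFDerivAt
  have h2 : HasFDerivAt (fun θ => α + lastCLM d θ) (lastCLM d) x :=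
    (lastCLM d).hasFDerivAt.const_add α
  refine ((h1.comp x (initCLM d).hasFDerivAt).add
    ((h2.cos).const_mul b)).fderiv.trans ?_
  rw [smul_smul, mul_neg]

theorem hessian_of_eq_add (hg : IsSmooth g) (z : Torus (d + 1)) {α : ℝ}
    (hα : Circle.exp α = z (Fin.last d)) (x y : Fin (d + 1) → ℝ) :
    hessian f z x y = hessian g (Fin.init z) (initCLM d x) (initCLM d y) +
      -(b * Real.cos α * lastCLM d x) * lastCLM d y := by
  unfold hessian
  have h0 := fderiv_comp_angle_eq hf hg z hα
  have h1 : HasFDerivAt (fderiv ℝ (fun θ => g (angle (Fin.init z) θ))) _ (initCLM d 0) :=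
    ((contDiff_infty_iff_fderiv.1 (hg (Fin.init z))).2.differentiable (by simp) _).hasFDerivAt
  have h2 : HasFDerivAt (fun θ => α + lastCLM d θ) (lastCLM d) 0 :=
    (lastCLM d).hasFDerivAt.const_add α
  have h3 := (((ContinuousLinearMap.compL ℝ (Fin (d + 1) → ℝ) (Fin d → ℝ) ℝ).flip
    (initCLM d)).hasFDerivAt.comp (0 : Fin (d + 1) → ℝ)
      (h1.comp 0 (initCLM d).hasFDerivAt)).add
    (((h2.sin.const_mul b).neg).smul_const (lastCLM d))
  have h4 := h3.fderiv
  change fderiv ℝ (fderiv ℝ fun θ => f (angle z θ)) 0 x y = _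
  rw [h0]
  refine (DFunLike.congr_fun (DFunLike.congr_fun h4 x) y).trans ?_
  simp [mul_assoc]

theorem mem_criticalPoints_of_eq_add (hg : IsSmooth g) (hb : b ≠ 0) (z : Torus (d + 1)) :
    z ∈ criticalPoints f ↔
      Fin.init z ∈ criticalPoints g ∧ (z (Fin.last d) : ℂ).im = 0 := by
  obtain ⟨α, hα⟩ := Circle.exp_surjective (z (Fin.last d))
  have him : (z (Fin.last d) : ℂ).im = Real.sin α := by
    rw [← hα, Circle.coe_exp, Complex.exp_ofReal_mul_I_im]
  rw [him]
  simp only [criticalPoints, Set.mem_ofPred_eq]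
  rw [fderiv_comp_angle_eq hf hg z hα]
  simp only [map_zero, add_zero]
  constructor
  · intro h
    constructor
    · ext y
      simpa using DFunLike.congr_fun h (Fin.snoc (α := fun _ => ℝ) y 0)
    · have := DFunLike.congr_fun h (Fin.snoc (α := fun _ => ℝ) 0 1)
      simpa [hb] using this
  · rintro ⟨h1, h2⟩
    rw [h1, h2]
    simp

theorem isMorse_of_eq_add (hg : IsMorse g) (hb : b ≠ 0) : IsMorse f := by
  refine ⟨isSmooth_of_eq_add hf hg.1, fun z hz x hx => ?_⟩
  obtain ⟨h1, h2⟩ := (mem_criticalPoints_of_eq_add hf hg.1 hb z).1 hz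
  obtain ⟨α, hα⟩ := Circle.exp_surjective (z (Fin.last d))
  rw [← hα, Circle.coe_exp, Complex.exp_ofReal_mul_I_im] at h2
  have hcos : Real.cos α ≠ 0 := fun h => by
    have := Real.sin_sq_add_cos_sq α
    simp [h, h2] at this
  simp only [hessian_of_eq_add hf hg.1 z hα] at hx
  refine eq_zero_of_initCLM_of_lastCLM (hg.2 _ h1 _ fun y => ?_) ?_
  · simpa using hx (Fin.snoc (α := fun _ => ℝ) y 0)
  · simpa [hb, hcos] using hx (Fin.snoc (α := fun _ => ℝ) 0 1)

theorem mk_criticalPoints_of_eq_add (hg : IsSmooth g) (hb : b ≠ 0) :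
    Cardinal.mk (criticalPoints f) = Cardinal.mk (criticalPoints g) * 2 := by
  have hS : Cardinal.mk {w : Circle | (w : ℂ).im = 0} = 2 := by
    have hne : (1 : Circle) ≠ Circle.exp Real.pi := fun h => by
      have := congrArg (fun w : Circle => (w : ℂ).re) h
      norm_num at this
    have : {w : Circle | (w : ℂ).im = 0} = {1, Circle.exp Real.pi} := by
      ext w
      simp only [Set.mem_ofPred_eq, Set.mem_insert_iff, Set.mem_singleton_iff, ← Circle.coe_inj,
        Complex.ext_iff, Circle.coe_exp, Complex.exp_ofReal_mul_I_re,
        Complex.exp_ofReal_mul_I_im, Circle.coe_one, Complex.one_re, Complex.one_im,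
        Real.sin_pi, Real.cos_pi, ← or_and_right]
      refine ⟨fun h => ⟨?_, h⟩, fun h => h.2⟩
      have := Circle.normSq_coe w
      rw [Complex.normSq_apply, h] at this
      exact mul_self_eq_one_iff.1 (by simpa using this)
    rw [this, Cardinal.mk_insert (by simpa using hne), Cardinal.mk_singleton]
    norm_num
  have hmem := mem_criticalPoints_of_eq_add hf hg hb
  rw [← hS, Cardinal.mul_def]
  refine Cardinal.mk_congr
    { toFun := fun z => (⟨Fin.init z.1, ((hmem _).1 z.2).1⟩,
        ⟨z.1 (Fin.last d), ((hmem _).1 z.2).2⟩)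
      invFun := fun x => ⟨Fin.snoc (α := fun _ => Circle) x.1.1 x.2.1, (hmem _).2 ⟨?_, ?_⟩⟩
      left_inv := fun z => Subtype.ext (Fin.snoc_init_self z.1)
      right_inv := fun x => ?_ }
  · rw [Fin.init_snoc]; exact x.1.2
  · rw [Fin.snoc_last]; exact x.2.2
  · refine Prod.ext (Subtype.ext ?_) (Subtype.ext ?_)
    · exact Fin.init_snoc (α := fun _ => Circle) x.2.1 x.1.1
    · exact Fin.snoc_last (α := fun _ => Circle) x.2.1 x.1.1

theorem isPerfectMorse_of_eq_add (hg : IsPerfectMorse g) (hb : b ≠ 0) : IsPerfectMorse f :=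
  ⟨isMorse_of_eq_add hf hg.1 hb, by
    rw [mk_criticalPoints_of_eq_add hf hg.1.1 hb, hg.2, totalBetti_torus_succ]⟩

end Torus

namespace Matrix.IsHermitian

variable {𝕜 n m : Type*} [RCLike 𝕜] [Fintype n] [DecidableEq n] [Fintype m] [DecidableEq m]

theorem eigenvalues₀_eq_of_charpoly_roots {A : Matrix n n 𝕜} (hA : A.IsHermitian)
    {l : Fin (Fintype.card n) → ℝ} (hl : Antitone l)
    (h : A.charpoly.roots = Multiset.map (RCLike.ofReal ∘ l) Finset.univ.val) :
    hA.eigenvalues₀ = l := by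
  rw [← List.ofFn_inj, ← sort_roots_charpoly_eq_eigenvalues₀, h]
  simp_rw [Fin.univ_val_map, Multiset.map_coe, List.map_ofFn,
    Function.comp_def, RCLike.ofReal_re, Multiset.coe_sort]
  apply List.mergeSort_of_pairwise
  simp_rw [decide_eq_true_eq, ← List.sortedGE_iff_pairwise]
  exact hl.sortedGE_ofFn

theorem eigenvalues₀_of_charpoly_eq_comp {A : Matrix n n 𝕜} {B : Matrix m m 𝕜}
    (hA : A.IsHermitian) (hB : B.IsHermitian) (e : Fintype.card m = Fintype.card n) (s : ℝ)
    (h : B.charpoly = A.charpoly.comp (Polynomial.X - Polynomial.C (s : 𝕜)))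
    (j : Fin (Fintype.card m)) :
    hB.eigenvalues₀ j = hA.eigenvalues₀ (Fin.cast e j) + s := by
  refine congrFun (hB.eigenvalues₀_eq_of_charpoly_roots (l := fun j =>
    hA.eigenvalues₀ (Fin.cast e j) + s) ?_ ?_) j
  · exact fun i j hij => add_le_add_left (hA.eigenvalues₀_antitone hij) s
  · have h1 : A.charpoly = ∏ i, (Polynomial.X - Polynomial.C (hA.eigenvalues₀ i : 𝕜)) := by
      rw [hA.charpoly_eq]
      exact Equiv.prod_comp _ fun i => Polynomial.X - Polynomial.C (hA.eigenvalues₀ i : 𝕜)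
    have h2 : B.charpoly = ∏ j, (Polynomial.X -
        Polynomial.C ((hA.eigenvalues₀ (Fin.cast e j) + s : ℝ) : 𝕜)) := by
      rw [h, h1, Polynomial.prod_comp]
      refine (Equiv.prod_comp (finCongr e) _).symm.trans (Finset.prod_congr rfl fun j _ => ?_)
      simp
      ring
    rw [h2, Polynomial.roots_prod]
    · simp only [Polynomial.roots_X_sub_C, Multiset.bind_singleton]
      rfl
    · exact Finset.prod_ne_zero_iff.2 fun _ _ => Polynomial.X_sub_C_ne_zero _

end Matrix.IsHermitian

theorem Matrix.charpoly_diagonal_conj_submatrix {R n m : Type*} [CommRing R] [Fintype n]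
    [DecidableEq n] [Fintype m] [DecidableEq m] (A : Matrix n n R) (e : m ≃ n) (x y : m → R)
    (hxy : ∀ i, x i * y i = 1) (s : R) (B : Matrix m m R)
    (hB : ∀ i j, B i j = x i * (A (e i) (e j) + if i = j then s else 0) * y j) :
    B.charpoly = A.charpoly.comp (Polynomial.X - Polynomial.C s) := by
  have h1 : B = Matrix.diagonal x *
      ((Matrix.reindex e.symm e.symm (A - Matrix.scalar n (-s))) * Matrix.diagonal y) := by
    ext i j
    rw [Matrix.diagonal_mul, Matrix.mul_diagonal, hB, ← mul_assoc]
    congr 2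
    by_cases h : i = j
    · subst h; simp
    · simp [h]
  rw [h1, Matrix.charpoly_mul_comm, Matrix.mul_assoc, Matrix.diagonal_mul_diagonal]
  have : (fun i => y i * x i) = fun _ => 1 := funext fun i => by rw [mul_comm, hxy]
  rw [this, Matrix.diagonal_one, Matrix.mul_one, Matrix.charpoly_reindex,
    Matrix.charpoly_sub_scalar, Polynomial.C_neg, ← sub_eq_add_neg]

namespace LabeledPeriodicGraph

variable {d : ℕ}

theorem monomial_add (z : Torus d) (a b : Fin d → ℤ) :
    monomial z (a + b) = monomial z a * monomial z b := by
  simp [monomial, zpow_add₀, Finset.prod_mul_distrib]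

@[simp] theorem monomial_zero (z : Torus d) : monomial z 0 = 1 := by
  simp [monomial]

theorem monomial_succ (z : Torus (d + 1)) (a : Fin (d + 1) → ℤ) :
    monomial z a =
      monomial (Fin.init z) (Fin.init a) * (z (Fin.last d) : ℂ) ^ a (Fin.last d) :=
  Fin.prod_univ_castSucc _

theorem finite_support_weight (Γ : LabeledPeriodicGraph.{u} d) (z : Torus d) (v w : Γ.Vert) :
    (Function.support fun a : Fin d → ℤ => (Γ.weight v (a +ᵥ w) : ℂ) * monomial z a).Finite := by
  refine (Γ.finite_adj_vadd v w).subset fun a ha => ?_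
  by_contra h
  exact ha (by simp [weight, show ¬ Γ.graph.Adj v (a +ᵥ w) from h])

/-- The Laurent polynomial `∑ E(v, a + w) z ^ a` over the edges from `v` to translates of `w`. -/
noncomputable def edgeSum (Γ : LabeledPeriodicGraph.{u} d) (z : Torus d) (v w : Γ.Vert) : ℂ :=
  ∑ᶠ a : Fin d → ℤ, (Γ.weight v (a +ᵥ w) : ℂ) * monomial z a

theorem edgeSum_vadd (Γ : LabeledPeriodicGraph.{u} d) (z : Torus d) (b c : Fin d → ℤ)
    (v w : Γ.Vert) :
    Γ.edgeSum z (b +ᵥ v) (c +ᵥ w) = monomial z b * Γ.edgeSum z v w * monomial z (-c) := by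
  unfold edgeSum
  rw [mul_finsum, finsum_mul, ← finsum_comp_equiv (Equiv.addRight (b - c))]
  refine finsum_congr fun a => ?_
  have h : (Equiv.addRight (b - c) a) +ᵥ (c +ᵥ w) = b +ᵥ (a +ᵥ w) := by
    rw [vadd_vadd, vadd_vadd, Equiv.coe_addRight]
    congr 1
    show a + (b - c) + c = b + a
    abel
  rw [h, weight_vadd, Equiv.coe_addRight, sub_eq_add_neg, monomial_add, monomial_add]
  ring

section parallel

variable (Γ : LabeledPeriodicGraph.{u} d) (a : ℝ)

open Classical in
theorem weight_parallelExtension (m n : ℤ) (v w : Γ.Vert) :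
    (Γ.parallelExtension a).weight (m, v) (n, w) =
      (if m = n then Γ.weight v w else 0) +
        if v = w then (if n = m + 1 then a else 0) + (if m = n + 1 then a else 0) else 0 := by
  have hadj : (Γ.parallelExtension a).graph.Adj (m, v) (n, w) ↔
      ((n = m + 1 ∨ m = n + 1) ∧ v = w) ∨ (Γ.graph.Adj v w ∧ m = n) := Iff.rfl
  unfold weight
  by_cases hvw : v = w
  · subst hvw
    have : ¬ Γ.graph.Adj v v := SimpleGraph.irrefl _
    by_cases h : n = m + 1 ∨ m = n + 1
    · rw [dif_pos (hadj.2 (Or.inl ⟨h, rfl⟩))]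
      change (if h : Γ.graph.Adj v v then Γ.E h else a) = _
      rcases h with h | h <;> simp [h, add_assoc]
    · rw [dif_neg (fun h' => by simpa [h, this] using hadj.1 h')]
      push Not at h
      simp [h]
  · by_cases h : Γ.graph.Adj v w
    · by_cases hmn : m = n
      · rw [dif_pos (hadj.2 (Or.inr ⟨h, hmn⟩))]
        change (if h : Γ.graph.Adj v w then Γ.E h else a) = _
        simp [h, hvw, hmn]
      · rw [dif_neg (fun h' => by simpa [hvw, hmn] using hadj.1 h')]
        simp [hvw, hmn]
    · rw [dif_neg (fun h' => by simpa [hvw, h] using hadj.1 h')]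
      simp [hvw, h]

variable {Γ}

open Classical in
theorem edgeSum_parallelExtension (z : Torus (d + 1)) {v w : Γ.Vert}
    (hvw : ∀ c : Fin d → ℤ, v = c +ᵥ w → v = w) :
    (Γ.parallelExtension a).edgeSum z ((0 : ℤ), v) ((0 : ℤ), w) =
      Γ.edgeSum (Fin.init z) v w +
        if v = w then ((2 * a * (z (Fin.last d) : ℂ).re : ℝ) : ℂ) else 0 := by
  have hc : ∀ c : Fin d → ℤ, v = c +ᵥ w ↔ c = 0 ∧ v = w := fun c => by
    refine ⟨fun h => ?_, fun ⟨h, h'⟩ => by rw [h, h', zero_vadd]⟩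
    have h' := hvw c h
    exact ⟨Γ.free c w (by rw [← h, h']), h'⟩
  let κ : ℂ := if v = w then (a : ℂ) else 0
  let ζ : ℂ := z (Fin.last d)
  let ι : (Fin d → ℤ) → ℤ → (Fin (d + 1) → ℤ) := fun c n => Fin.snoc (α := fun _ => ℤ) c n
  have hι : ∀ c n c' n', ι c n = ι c' n' ↔ c = c' ∧ n = n' := fun c n c' n' =>
    ⟨fun h => Fin.snoc_injective2 h, fun ⟨h, h'⟩ => by rw [h, h']⟩
  let g : (Fin d → ℤ) → ℂ := fun c => (Γ.weight v (c +ᵥ w) : ℂ) * monomial (Fin.init z) c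
  have hg : g.HasFiniteSupport := Γ.finite_support_weight _ v w
  let f₁ : (Fin (d + 1) → ℤ) → ℂ := (Set.range fun c => ι c 0).indicator fun b => g (Fin.init b)
  let f₂ : (Fin (d + 1) → ℤ) → ℂ := fun b => if b = ι 0 1 then κ * ζ else 0
  let f₃ : (Fin (d + 1) → ℤ) → ℂ := fun b => if b = ι 0 (-1) then κ * ζ⁻¹ else 0
  have s₁ : f₁.HasFiniteSupport := by
    refine Set.Finite.subset (Set.Finite.image (fun c => ι c 0) hg) fun b hb => ?_
    obtain ⟨c, rfl⟩ := Set.mem_of_indicator_ne_zero hb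
    have hb' := Set.indicator_apply_ne_zero.1 hb
    refine ⟨c, ?_, rfl⟩
    simpa [ι] using hb'.2
  have s₂ : f₂.HasFiniteSupport := (Set.finite_singleton (ι 0 1)).subset fun b hb => by
    by_contra h; exact hb (if_neg h)
  have s₃ : f₃.HasFiniteSupport := (Set.finite_singleton (ι 0 (-1))).subset fun b hb => by
    by_contra h; exact hb (if_neg h)
  have e₁ : ∑ᶠ b, f₁ b = Γ.edgeSum (Fin.init z) v w := by
    rw [← finsum_mem_def, finsum_mem_range fun c c' h => ((hι _ _ _ _).1 h).1]
    exact finsum_congr fun c => by simp [ι, g]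
  have e₂ : ∑ᶠ b, f₂ b = κ * ζ :=
    (finsum_eq_single _ (ι 0 1) fun b hb => if_neg hb).trans (if_pos rfl)
  have e₃ : ∑ᶠ b, f₃ b = κ * ζ⁻¹ :=
    (finsum_eq_single _ (ι 0 (-1)) fun b hb => if_neg hb).trans (if_pos rfl)
  have key : (Γ.parallelExtension a).edgeSum z ((0 : ℤ), v) ((0 : ℤ), w) =
      ∑ᶠ b, (f₁ b + f₂ b + f₃ b) := by
    refine finsum_congr fun b => ?_
    obtain ⟨c, n, rfl⟩ : ∃ c n, b = ι c n := ⟨Fin.init b, b (Fin.last d), (Fin.snoc_init_self b).symm⟩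
    have h1 : ι c n +ᵥ (show (Γ.parallelExtension a).Vert from ((0 : ℤ), w)) = (n, c +ᵥ w) := by
      refine Prod.ext ?_ ?_
      · change Fin.snoc (α := fun _ => ℤ) c n (Fin.last d) + 0 = n
        simp
      · change (Fin.init (Fin.snoc (α := fun _ => ℤ) c n) : Fin d → ℤ) +ᵥ w = c +ᵥ w
        rw [Fin.init_snoc]
    have h2 : monomial z (ι c n) = monomial (Fin.init z) c * ζ ^ n := by
      rw [monomial_succ]; simp [ι, ζ]
    have h3 : f₁ (ι c n) = if n = 0 then g c else 0 := by
      have : ι c n ∈ (Set.range fun c => ι c 0) ↔ n = 0 := by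
        simp [hι, eq_comm]
      simp only [f₁, Set.indicator_apply, this]
      simp [ι]
    have h4 : f₂ (ι c n) = if c = 0 ∧ n = 1 then κ * ζ else 0 := by simp only [f₂, hι]
    have h5 : f₃ (ι c n) = if c = 0 ∧ n = -1 then κ * ζ⁻¹ else 0 := by simp only [f₃, hι]
    rw [h2, h3, h4, h5]
    have h6 := Γ.weight_parallelExtension a 0 n v (c +ᵥ w)
    have h7 : (0 = n + 1) ↔ n = -1 := by omega
    simp only [hc, h7] at h6
    refine (congrArg (fun x => (((Γ.parallelExtension a).weight ((0 : ℤ), v) x : ℝ) : ℂ) * _)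
      h1).trans ?_
    rw [h6]
    by_cases n0 : n = 0
    · subst n0; simp [g]
    · by_cases n1 : n = 1
      · subst n1
        by_cases c0 : c = 0
        · subst c0; by_cases h : v = w <;> simp [h, κ]
        · simp [c0]
      · by_cases n2 : n = -1
        · subst n2
          by_cases c0 : c = 0
          · subst c0; by_cases h : v = w <;> simp [h, κ]
          · simp [c0]
        · simp [n0, n1, n2, Ne.symm n0]
  have s₁₂ : (fun b => f₁ b + f₂ b).HasFiniteSupport := s₁.add s₂
  rw [key, finsum_add_distrib s₁₂ s₃, finsum_add_distrib s₁ s₂, e₁, e₂, e₃, add_assoc]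
  congr 1
  by_cases h : v = w
  · simp only [κ, ζ, if_pos h]
    rw [← mul_add, ← Circle.coe_inv, Circle.coe_inv_eq_conj, Complex.add_conj]
    push_cast
    ring
  · simp [κ, h]

end parallel

end LabeledPeriodicGraph

namespace LabeledPeriodicGraph

variable {d : ℕ} {Γ : LabeledPeriodicGraph.{u} d}

theorem FundamentalDomain.eq_of_vadd_eq (W : Γ.FundamentalDomain) {v w : Γ.Vert}
    (hv : v ∈ W.carrier) (hw : w ∈ W.carrier) {c : Fin d → ℤ} (h : v = c +ᵥ w) : v = w :=
  (W.existsUnique_mem v).unique ⟨hv, 0, zero_vadd _ _⟩ ⟨hw, c, h.symm⟩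

/-- A fundamental domain of a parallel extension projects to translates of a fundamental domain
of the original graph. -/
theorem FundamentalDomain.exists_equiv_parallelExtension (W : Γ.FundamentalDomain) {a : ℝ}
    (W' : (Γ.parallelExtension a).FundamentalDomain) :
    ∃ (e : W'.carrier ≃ W.carrier) (β : W'.carrier → Fin (d + 1) → ℤ),
      ∀ u : W'.carrier, (u : (Γ.parallelExtension a).Vert) =
        β u +ᵥ (show (Γ.parallelExtension a).Vert from ((0 : ℤ), ((e u : W.carrier) : Γ.Vert))) := by
  have hvadd : ∀ (b : Fin (d + 1) → ℤ) (p : (Γ.parallelExtension a).Vert),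
      b +ᵥ p = (b (Fin.last d) + p.1, (Fin.init b : Fin d → ℤ) +ᵥ p.2) := fun _ _ => rfl
  choose r hr c hc using fun v => (W.existsUnique_mem v).exists
  let β : W'.carrier → Fin (d + 1) → ℤ := fun u =>
    Fin.snoc (α := fun _ => ℤ) (c u.1.2) u.1.1
  have hβ : ∀ u : W'.carrier, (u : (Γ.parallelExtension a).Vert) =
      β u +ᵥ (show (Γ.parallelExtension a).Vert from ((0 : ℤ), r u.1.2)) := by
    intro u
    rw [hvadd]
    refine Prod.ext ?_ ?_
    · simp [β]
    · change _ = (Fin.init (Fin.snoc (α := fun _ => ℤ) (c u.1.2) u.1.1) : Fin d → ℤ) +ᵥ r u.1.2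
      rw [Fin.init_snoc, hc]
  let e : W'.carrier → W.carrier := fun u => ⟨r u.1.2, hr _⟩
  have he : Function.Bijective e := by
    constructor
    · intro u u' h
      have h' : r u.1.2 = r u'.1.2 := congrArg Subtype.val h
      refine Subtype.ext (W'.eq_of_vadd_eq u.2 u'.2 (c := β u - β u') ?_)
      have h1 := hβ u
      rw [h'] at h1
      rw [sub_eq_add_neg, add_vadd]
      refine h1.trans ?_
      congr 1
      exact (neg_vadd_eq_iff.2 (hβ u')).symm
    · intro w
      obtain ⟨u, hu, b, hb⟩ := (W'.existsUnique_mem ((0 : ℤ), (w : Γ.Vert))).exists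
      refine ⟨⟨u, hu⟩, Subtype.ext ?_⟩
      have h1 : (Fin.init b : Fin d → ℤ) +ᵥ u.2 = w := congrArg Prod.snd hb
      refine (W.eq_of_vadd_eq w.2 (hr u.2) (c := Fin.init b + c u.2) ?_).symm
      rw [add_vadd, hc, h1]
  exact ⟨Equiv.ofBijective e he, β, hβ⟩

theorem band_parallelExtension (W : Γ.FundamentalDomain) {a : ℝ}
    (W' : (Γ.parallelExtension a).FundamentalDomain) :
    ∃ e : Fintype.card W'.carrier = Fintype.card W.carrier, ∀ j z,
      band W' j z =
        band W (Fin.cast e j) (Fin.init z) + 2 * a * (z (Fin.last d) : ℂ).re := by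
  classical
  obtain ⟨e, β, hβ⟩ := W.exists_equiv_parallelExtension W'
  refine ⟨Fintype.card_congr e, fun j z => ?_⟩
  refine Matrix.IsHermitian.eigenvalues₀_of_charpoly_eq_comp (floquetMatrix_isHermitian W _)
    (floquetMatrix_isHermitian W' z) _ _ ?_ j
  refine Matrix.charpoly_diagonal_conj_submatrix _ e (fun u => monomial z (β u))
    (fun u => monomial z (-β u)) (fun u => by rw [← monomial_add, add_neg_cancel, monomial_zero])
    _ _ fun u u' => ?_
  have h1 := (Γ.parallelExtension a).edgeSum_vadd z (β u) (β u')
    ((0 : ℤ), ((e u : W.carrier) : Γ.Vert)) ((0 : ℤ), ((e u' : W.carrier) : Γ.Vert))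
  have h2 := edgeSum_parallelExtension (Γ := Γ) a z (v := e u) (w := e u')
    fun c h => W.eq_of_vadd_eq (e u).2 (e u').2 h
  have h3 := (congrArg₂ ((Γ.parallelExtension a).edgeSum z) (hβ u) (hβ u')).trans (h1.trans
    (congrArg (fun t => monomial z (β u) * t * monomial z (-β u')) h2))
  have h4 : (Γ.parallelExtension a).V u = Γ.V (e u) :=
    (congrArg _ (hβ u)).trans ((Γ.parallelExtension a).V_vadd _ _)
  have h5 : ((e u : W.carrier) : Γ.Vert) = e u' ↔ u = u' := by simp
  change (if u = u' then (((Γ.parallelExtension a).V u : ℝ) : ℂ) else 0) +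
    (Γ.parallelExtension a).edgeSum z u u' = monomial z (β u) *
      ((if e u = e u' then ((Γ.V (e u) : ℝ) : ℂ) else 0) + Γ.edgeSum (Fin.init z) (e u) (e u') +
        _) * monomial z (-β u')
  rw [h3, h4]
  simp only [h5, e.apply_eq_iff_eq]
  by_cases h : u = u'
  · subst h
    have : monomial z (β u) * monomial z (-β u) = 1 := by
      rw [← monomial_add, add_neg_cancel, monomial_zero]
    simp only [if_true]
    linear_combination -((Γ.V (e u) : ℝ) : ℂ) * this
  · simp [h]

end LabeledPeriodicGraph

theorem mainTheorem7 {d : ℕ} (Γ : LabeledPeriodicGraph.{u} d) (W : Γ.FundamentalDomain)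
    (hΓ : ∀ j : Fin (Fintype.card W.carrier),
      Torus.IsPerfectMorse (LabeledPeriodicGraph.band W j))
    (a : ℝ) (ha : a ≠ 0) (W' : (Γ.parallelExtension a).FundamentalDomain) :
    ∀ j : Fin (Fintype.card W'.carrier),
      Torus.IsPerfectMorse (LabeledPeriodicGraph.band W' j) := by
  obtain ⟨e, he⟩ := LabeledPeriodicGraph.band_parallelExtension W W'
  exact fun j => Torus.isPerfectMorse_of_eq_add (he j) (hΓ (Fin.cast e j)) (by simpa using ha)
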